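/- Let $S$ be a commutative semiring with $1$. A strong ideal of $S$ is an ideal $I$ such that, for all $a,b\in S$, $a+b\in I$ implies $a\in I$ and $b\in I$. For a collection $X$ of ideals of $S$, the hull-kernel topology on $X$ is the topology having the sets $\{I\in X \mid A\nsubseteq I\}$, $A$ a finite subset of $S$, as a subbasis of open sets (equivalently, the sets $\{I\in X\mid A\subseteq I\}$ as a subbasis of closed sets). The power set $2^S$ carries the analogous topology, with subbasic open sets $\{I\in 2^S\mid A\nsubseteq I\}$, $A\subseteq S$ finite; the patch topology on $2^S$ is the topology generated by the quasi-compact open sets of that topology together with their complements. A space is spectral if it is quasi-compact, $T_0$ and sober, its quasi-compact open sets form a basis, and the intersection of any two quasi-compact open sets is quasi-compact. Then: 1. The collection of all strong ideals of $S$, with the hull-kernel topology, is a spectral space, and it is a patch-closed subset of $2^S$. The same holds for the collection of all proper strong ideals of $S$. 2. The collection of all strong prime ideals of $S$, with the hull-kernel topology, is a spectral space, and it is a patch-closed subset of $2^S$. -/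

import Mathlib

open Topology

/-- An ideal `I` of a semiring is strong if `a + b ∈ I` implies `a ∈ I` and `b ∈ I`. -/
def Ideal.IsStrong {S : Type*} [CommSemiring S] (I : Ideal S) : Prop :=
  ∀ a b : S, a + b ∈ I → a ∈ I ∧ b ∈ I

/-- The collection of all strong ideals of `S` (including the improper ideal `S`). -/
def strongIdeals (S : Type*) [CommSemiring S] : Set (Ideal S) :=
  {I | I.IsStrong}

/-- The collection of all proper strong ideals of `S`. -/
def properStrongIdeals (S : Type*) [CommSemiring S] : Set (Ideal S) :=
  {I | I ≠ ⊤ ∧ I.IsStrong}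

/-- The collection of all strong prime ideals of `S`. -/
def strongPrimeIdeals (S : Type*) [CommSemiring S] : Set (Ideal S) :=
  {I | I.IsPrime ∧ I.IsStrong}

/-- The hull-kernel topology on `2^S`: the sets `D(A) = {I | A ⊈ I}`, for finite `A ⊆ S`, form a
subbasis of open sets; equivalently, the hulls `{I | A ⊆ I}` form a subbasis of closed sets. -/
abbrev powersetHullKernel (S : Type*) : TopologicalSpace (Set S) :=
  TopologicalSpace.generateFrom {U | ∃ A : Finset S, U = {I : Set S | ¬ (A : Set S) ⊆ I}}

/-- The hull-kernel topology on a collection `X` of ideals of `S`: the sets `{I ∈ X | A ⊈ I}`, for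
finite `A ⊆ S`, form a subbasis of open sets. -/
abbrev hullKernel {S : Type*} [CommSemiring S] (X : Set (Ideal S)) : TopologicalSpace X :=
  TopologicalSpace.generateFrom {U | ∃ A : Finset S, U = {I : X | ¬ (A : Set S) ⊆ (I : Ideal S)}}

/-- The patch topology on `2^S`: the constructible topology of the hull-kernel topology, generated
by the quasi-compact open sets (of the hull-kernel topology) and their complements. -/
abbrev powersetPatch (S : Type*) : TopologicalSpace (Set S) :=
  @constructibleTopology (Set S) (powersetHullKernel S)

/-- A collection of ideals of `S`, regarded as a subset of `2^S`, is patch-closed. -/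
def IsPatchClosed {S : Type*} [CommSemiring S] (X : Set (Ideal S)) : Prop :=
  IsClosed[powersetPatch S] ((fun I : Ideal S => (I : Set S)) '' X)

open Filter

/-! Being an ideal, strong, proper or prime is a conjunction of conditions "finitely many
memberships imply a finite disjunction of memberships". An ultrafilter commutes with finite
conjunctions, disjunctions and negations, so each family is closed under ultralimits. This closure
suffices: the ultralimit is a limit in the topology generated by the sets `{x | a ∉ p x}`, giving
compactness and generic points, and it is the only possible patch limit in `2^S`. -/

/-- The limit of an ultrafilter on `2^S`: the set of all points lying in almost every member. -/
def ultralimit {S : Type*} (U : Ultrafilter (Set S)) : Set S :=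
  {a | ∀ᶠ I : Set S in U, a ∈ I}

theorem mem_ultralimit {S : Type*} {U : Ultrafilter (Set S)} {a : S} :
    a ∈ ultralimit U ↔ ∀ᶠ I : Set S in U, a ∈ I := Iff.rfl

theorem notMem_ultralimit {S : Type*} {U : Ultrafilter (Set S)} {a : S} :
    a ∉ ultralimit U ↔ ∀ᶠ I : Set S in U, a ∉ I :=
  Ultrafilter.eventually_not.symm

/-- A collection of subsets of `S` is closed under ultralimits. -/
def UltralimitClosed {S : Type*} (P : Set (Set S)) : Prop :=
  ∀ U : Ultrafilter (Set S), P ∈ U → ultralimit U ∈ P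

theorem UltralimitClosed.exists_limit {S X : Type*} {p : X → Set S}
    (hP : UltralimitClosed (Set.range p)) (U : Ultrafilter X) :
    ∃ x, ∀ a, (a ∈ p x ↔ ∀ᶠ y in U, a ∈ p y) ∧ (a ∉ p x ↔ ∀ᶠ y in U, a ∉ p y) := by
  obtain ⟨x, hx⟩ := hP (U.map p) (Filter.mem_map.2 (Filter.univ_mem' fun y ↦ ⟨y, rfl⟩))
  refine ⟨x, fun a ↦ ?_⟩
  rw [hx, notMem_ultralimit, mem_ultralimit]
  exact ⟨Iff.rfl, Iff.rfl⟩

section Spectral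

variable {S X : Type*} {p : X → Set S}

theorem isTopologicalBasis_forall_notMem [t : TopologicalSpace X]
    (ht : t = TopologicalSpace.generateFrom (Set.range fun a ↦ {x | a ∉ p x})) :
    TopologicalSpace.IsTopologicalBasis
      (Set.range fun F : Finset S ↦ {x | ∀ a ∈ F, a ∉ p x}) := by
  classical
  convert TopologicalSpace.isTopologicalBasis_of_subbasis ht using 1
  ext B
  constructor
  · rintro ⟨F, rfl⟩
    refine ⟨(fun a ↦ {x | a ∉ p x}) '' F, ⟨F.finite_toSet.image _, ?_⟩, ?_⟩
    · exact Set.image_subset_range _ _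
    · ext x; simp
  · rintro ⟨f, ⟨hf, hfs⟩, rfl⟩
    rw [← Set.image_univ] at hfs
    obtain ⟨F, -, hF⟩ := Set.exists_subset_image_finite_and.1 ⟨f, hfs, hf, rfl⟩
    refine ⟨hF.1.toFinset, ?_⟩
    simp only [hF.2]
    ext x; simp

/-- Only non-membership has to persist, since the subbasic open sets test nothing else. -/
theorem le_nhds_of_forall_notMem [t : TopologicalSpace X]
    (ht : t = TopologicalSpace.generateFrom (Set.range fun a ↦ {x | a ∉ p x}))
    {l : Filter X} {x : X} (h : ∀ a, a ∉ p x → ∀ᶠ y in l, a ∉ p y) : l ≤ 𝓝 x := by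
  subst ht
  rw [TopologicalSpace.nhds_generateFrom]
  refine le_iInf₂ ?_
  rintro _ ⟨hx, a, rfl⟩
  exact le_principal_iff.2 (h a hx)

theorem isCompact_forall_notMem [t : TopologicalSpace X]
    (ht : t = TopologicalSpace.generateFrom (Set.range fun a ↦ {x | a ∉ p x}))
    (hP : UltralimitClosed (Set.range p)) (F : Finset S) :
    IsCompact {x | ∀ a ∈ F, a ∉ p x} := by
  rw [isCompact_iff_ultrafilter_le_nhds]
  intro U hU
  obtain ⟨x, hx⟩ := hP.exists_limit U
  refine ⟨x, fun a ha ↦ (hx a).2.2 ?_, le_nhds_of_forall_notMem ht fun a ↦ (hx a).2.1⟩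
  filter_upwards [le_principal_iff.1 hU] with y hy using hy a ha

/-- The generic point is the limit of an ultrafilter containing `Z ∩ u` for every open `u` meeting
`Z`: any `a` omitted by some point of `Z` is then omitted by the limit. -/
theorem quasiSober_of_ultralimitClosed [t : TopologicalSpace X]
    (ht : t = TopologicalSpace.generateFrom (Set.range fun a ↦ {x | a ∉ p x}))
    (hP : UltralimitClosed (Set.range p)) : QuasiSober X where
  sober {Z} hZ hZc := by
    let ι := {u : Set X // IsOpen u ∧ (Z ∩ u).Nonempty}
    have : Nonempty ι := ⟨⟨Set.univ, isOpen_univ, by simpa using hZ.1⟩⟩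
    have hne : NeBot (⨅ u : ι, 𝓟 (Z ∩ u.1)) := by
      -- Irreducibility of `Z` makes the family directed.
      refine iInf_neBot_of_directed' (fun u v ↦ ?_) fun u ↦ principal_neBot_iff.2 u.2.2
      refine ⟨⟨u.1 ∩ v.1, u.2.1.inter v.2.1, hZ.2 _ _ u.2.1 v.2.1 u.2.2 v.2.2⟩, ?_, ?_⟩
      · exact principal_mono.2 (Set.inter_subset_inter_right _ Set.inter_subset_left)
      · exact principal_mono.2 (Set.inter_subset_inter_right _ Set.inter_subset_right)
    let U := Ultrafilter.of (⨅ u : ι, 𝓟 (Z ∩ u.1))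
    have hU (u : ι) : Z ∩ u.1 ∈ U :=
      le_principal_iff.1 ((Ultrafilter.of_le _).trans (iInf_le _ u))
    obtain ⟨x, hx⟩ := hP.exists_limit U
    have hxZ : x ∈ Z := isClosed_iff_ultrafilter.1 hZc x U
      (le_nhds_of_forall_notMem ht fun a ↦ (hx a).2.1)
      (mem_of_superset (hU (Classical.arbitrary ι)) Set.inter_subset_left)
    refine ⟨x, (hZc.closure_subset_iff.2 (by simpa using hxZ)).antisymm fun z hz ↦ ?_⟩
    rw [← specializes_iff_mem_closure, specializes_iff_pure]
    refine le_nhds_of_forall_notMem ht fun a ha ↦ ?_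
    have hao : IsOpen {y | a ∉ p y} := by
      subst ht
      exact TopologicalSpace.isOpen_generateFrom_of_mem ⟨a, rfl⟩
    exact eventually_pure.2 ((hx a).2.2 (mem_of_superset (hU ⟨_, hao, z, hz, ha⟩) Set.inter_subset_right))

theorem spectralSpace_of_ultralimitClosed [t : TopologicalSpace X]
    (ht : t = TopologicalSpace.generateFrom (Set.range fun a ↦ {x | a ∉ p x}))
    (hp : Function.Injective p) (hP : UltralimitClosed (Set.range p)) : SpectralSpace X := by
  classical
  have hopen (a : S) : IsOpen {x | a ∉ p x} := by
    subst ht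
    exact TopologicalSpace.isOpen_generateFrom_of_mem ⟨a, rfl⟩
  have hb := isTopologicalBasis_forall_notMem ht
  have hc := isCompact_forall_notMem ht hP
  have : T0Space X := by
    refine ⟨fun x y hxy ↦ hp (Set.ext fun a ↦ ?_)⟩
    simpa using not_congr (hxy.mem_open_iff (hopen a))
  have : CompactSpace X := ⟨by simpa using hc ∅⟩
  have := quasiSober_of_ultralimitClosed ht hP
  have : PrespectralSpace X := .of_isTopologicalBasis hb (by rintro _ ⟨F, rfl⟩; exact hc F)
  have : QuasiSeparatedSpace X := by
    refine .of_isTopologicalBasis (ι := Finset S) (b := fun F ↦ {x | ∀ a ∈ F, a ∉ p x}) hb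
      fun F G ↦ ?_
    convert hc (F ∪ G) using 1
    ext x
    simp only [Set.mem_inter_iff, Set.mem_ofPred_eq, Finset.mem_union]
    grind
  exact {}

end Spectral

theorem generateFrom_not_subset {S X : Type*} (p : X → Set S) :
    TopologicalSpace.generateFrom {U | ∃ A : Finset S, U = {x | ¬ (A : Set S) ⊆ p x}} =
      TopologicalSpace.generateFrom (Set.range fun a ↦ {x | a ∉ p x}) := by
  apply le_antisymm
  · refine le_generateFrom ?_
    rintro _ ⟨a, rfl⟩
    exact TopologicalSpace.isOpen_generateFrom_of_mem ⟨{a}, by simp⟩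
  · refine le_generateFrom ?_
    rintro _ ⟨A, rfl⟩
    have : {x | ¬ (A : Set S) ⊆ p x} = ⋃ a ∈ A, {x | a ∉ p x} := by
      ext x; simp [Set.not_subset]
    rw [this]
    exact @isOpen_biUnion _ _ (_) _ _ fun a _ ↦
      TopologicalSpace.isOpen_generateFrom_of_mem ⟨a, rfl⟩

/-- Each `{I | a ∉ I}` is compact open, hence patch-clopen, so a patch limit of `U` must agree with
`ultralimit U` at every `a`. -/
theorem UltralimitClosed.isClosed_powersetPatch {S : Type*} {P : Set (Set S)}
    (hP : UltralimitClosed P) : IsClosed[powersetPatch S] P := by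
  let _ : TopologicalSpace (Set S) := powersetHullKernel S
  have ht : powersetHullKernel S =
      TopologicalSpace.generateFrom (Set.range fun a ↦ {I : Set S | a ∉ I}) :=
    generateFrom_not_subset (p := id)
  have hc (a : S) : IsCompact {I : Set S | a ∉ I} := by
    -- All of `2^S` is trivially closed under ultralimits.
    simpa using isCompact_forall_notMem (p := id) ht (fun U _ ↦ ⟨_, rfl⟩) {a}
  have ho (a : S) : IsOpen {I : Set S | a ∉ I} := by
    exact TopologicalSpace.isOpen_generateFrom_of_mem ⟨{a}, by simp⟩
  have ho₁ (a : S) : IsOpen[powersetPatch S] {I : Set S | a ∉ I} :=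
    (hc a).isOpen_constructibleTopology_of_isOpen (ho a)
  have ho₂ (a : S) : IsOpen[powersetPatch S] {I : Set S | a ∈ I} := by
    refine IsCompact.isOpen_constructibleTopology_of_isClosed (hc a) ⟨ho a⟩
  refine (@isClosed_iff_ultrafilter _ _ (powersetPatch S)).2 fun I U hU hPU ↦ ?_
  convert hP U hPU
  ext a
  refine ⟨fun ha ↦ hU (@IsOpen.mem_nhds _ (powersetPatch S) _ _ (ho₂ a) ha), fun ha ↦ ?_⟩
  by_contra hn
  exact notMem_ultralimit.2 (hU (@IsOpen.mem_nhds _ (powersetPatch S) _ _ (ho₁ a) hn)) ha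

section Ideals

variable {S : Type*} [CommSemiring S]

theorem spectralSpace_and_isPatchClosed {X : Set (Ideal S)}
    (hX : UltralimitClosed ((fun I : Ideal S ↦ (I : Set S)) '' X)) :
    @SpectralSpace X (hullKernel X) ∧ IsPatchClosed X := by
  refine ⟨?_, hX.isClosed_powersetPatch⟩
  refine @spectralSpace_of_ultralimitClosed S X (fun I ↦ (I : Ideal S)) (hullKernel X)
    (generateFrom_not_subset _) (fun I J h ↦ Subtype.ext (SetLike.coe_injective h)) ?_
  rwa [Set.image_eq_range] at hX

/-- The ultralimit of ideals, as an ideal. -/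
def ultralimitIdeal (U : Ultrafilter (Set S))
    (hU : ∀ᶠ I in U, ∃ J : Ideal S, (J : Set S) = I) : Ideal S where
  carrier := ultralimit U
  zero_mem' := by
    refine mem_ultralimit.2 (hU.mono ?_)
    rintro _ ⟨J, rfl⟩
    exact J.zero_mem
  add_mem' {a b} ha hb := by
    refine mem_ultralimit.2 ?_
    filter_upwards [hU, ha, hb]
    rintro _ ⟨J, rfl⟩ ha hb
    exact J.add_mem ha hb
  smul_mem' c a ha := by
    refine mem_ultralimit.2 ?_
    filter_upwards [hU, ha]
    rintro _ ⟨J, rfl⟩ ha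
    exact J.smul_mem c ha

theorem ultralimitClosed_image {X : Set (Ideal S)}
    (h : ∀ (U : Ultrafilter (Set S)) (L : Ideal S), (L : Set S) = ultralimit U →
      (∀ᶠ I in U, ∃ J ∈ X, (J : Set S) = I) → L ∈ X) :
    UltralimitClosed ((fun I : Ideal S ↦ (I : Set S)) '' X) := fun U hU ↦
  ⟨ultralimitIdeal U (Eventually.mono hU fun _ ⟨J, _, h⟩ ↦ ⟨J, h⟩), h U _ rfl hU, rfl⟩

variable {U : Ultrafilter (Set S)} {L : Ideal S}

theorem Ideal.isStrong_of_eq_ultralimit (hL : (L : Set S) = ultralimit U)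
    (hU : ∀ᶠ I in U, ∃ J : Ideal S, J.IsStrong ∧ (J : Set S) = I) : L.IsStrong := by
  intro a b hab
  simp only [← SetLike.mem_coe, hL, mem_ultralimit] at hab ⊢
  rw [← eventually_and]
  filter_upwards [hU, hab]
  rintro _ ⟨J, hJ, rfl⟩ hab
  exact hJ a b hab

theorem Ideal.ne_top_of_eq_ultralimit (hL : (L : Set S) = ultralimit U)
    (hU : ∀ᶠ I in U, ∃ J : Ideal S, J ≠ ⊤ ∧ (J : Set S) = I) : L ≠ ⊤ := by
  rw [Ideal.ne_top_iff_one, ← SetLike.mem_coe, hL, notMem_ultralimit]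
  refine hU.mono ?_
  rintro _ ⟨J, hJ, rfl⟩
  exact (Ideal.ne_top_iff_one J).1 hJ

theorem Ideal.isPrime_of_eq_ultralimit (hL : (L : Set S) = ultralimit U)
    (hU : ∀ᶠ I in U, ∃ J : Ideal S, J.IsPrime ∧ (J : Set S) = I) : L.IsPrime where
  ne_top' := Ideal.ne_top_of_eq_ultralimit hL (hU.mono fun _ ⟨J, hJ, h⟩ ↦ ⟨J, hJ.ne_top, h⟩)
  mem_or_mem' {a b} hab := by
    simp only [← SetLike.mem_coe, hL, mem_ultralimit] at hab ⊢
    -- A general filter would not split this disjunction.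
    rw [← Ultrafilter.eventually_or]
    filter_upwards [hU, hab]
    rintro _ ⟨J, hJ, rfl⟩ hab
    exact hJ.mem_or_mem hab

end Ideals

theorem proposition4 (S : Type*) [CommSemiring S] :
    (@SpectralSpace (strongIdeals S) (hullKernel (strongIdeals S)) ∧
      IsPatchClosed (strongIdeals S)) ∧
    (@SpectralSpace (properStrongIdeals S) (hullKernel (properStrongIdeals S)) ∧
      IsPatchClosed (properStrongIdeals S)) ∧
    (@SpectralSpace (strongPrimeIdeals S) (hullKernel (strongPrimeIdeals S)) ∧
      IsPatchClosed (strongPrimeIdeals S)) := by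
  refine ⟨spectralSpace_and_isPatchClosed (ultralimitClosed_image fun U L hL hU ↦ ?_),
    spectralSpace_and_isPatchClosed (ultralimitClosed_image fun U L hL hU ↦ ?_),
    spectralSpace_and_isPatchClosed (ultralimitClosed_image fun U L hL hU ↦ ?_)⟩
  · exact Ideal.isStrong_of_eq_ultralimit hL hU
  · exact ⟨Ideal.ne_top_of_eq_ultralimit hL (hU.mono fun _ ⟨J, hJ, h⟩ ↦ ⟨J, hJ.1, h⟩),
      Ideal.isStrong_of_eq_ultralimit hL (hU.mono fun _ ⟨J, hJ, h⟩ ↦ ⟨J, hJ.2, h⟩)⟩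
  · exact ⟨Ideal.isPrime_of_eq_ultralimit hL (hU.mono fun _ ⟨J, hJ, h⟩ ↦ ⟨J, hJ.1, h⟩),
      Ideal.isStrong_of_eq_ultralimit hL (hU.mono fun _ ⟨J, hJ, h⟩ ↦ ⟨J, hJ.2, h⟩)⟩
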